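/- Let $k$ be a field. Let $\mathcal{C}$ be the category whose objects are the finite sets and in which a morphism from $X$ to $Y$ is a correspondence, i.e. a subset of $Y\times X$, with composition $RS=\{(z,x)\mid \exists\, y\in Y,\ (z,y)\in R \text{ and } (y,x)\in S\}$ for $R\subseteq Z\times Y$ and $S\subseteq Y\times X$. Let $k\mathcal{C}$ be its $k$-linearization: it has the same objects, and its morphisms are the formal $k$-linear combinations of correspondences. A correspondence functor over $k$ is a $k$-linear functor from $k\mathcal{C}$ to the category of $k$-modules. It is finitely generated if there are finitely many elements $m_i\in M(E_i)$ $(1\le i\le n)$, with $E_i$ finite sets, such that for every finite set $X$ every element of $M(X)$ has the form $\sum_i \alpha_i m_i$ with $\alpha_i$ a morphism of $k\mathcal{C}$ from $E_i$ to $X$. A correspondence functor is simple if it is nonzero and has no proper nonzero subfunctor. Theorem. Let $M$ be a finitely generated correspondence functor over the field $k$. Then $M$ has finite length, that is, there is a finite chain of subfunctors $M=F_0\supseteq F_1\supseteq\dots\supseteq F_n=0$ such that every quotient $F_i/F_{i+1}$ is simple. Moreover, every subfunctor of $M$ is finitely generated, and every nonzero subfunctor $N$ of $M$ (in particular $M$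 itself, if $M\neq 0$) has a maximal subfunctor, i.e. a subfunctor $F\subsetneq N$ with no subfunctor strictly between $F$ and $N$. -/

import Mathlib

open CategoryTheory

universe u v w

/-- An object of the category `𝒞` of finite sets and correspondences: a finite set. -/
structure FinCorr : Type (u + 1) where
  carrier : Type u
  [finite : Finite carrier]

namespace FinCorr

attribute [instance] FinCorr.finite

/-- A correspondence from `X` to `Y`: a subset of `Y × X`. -/
@[ext]
structure Correspondence (X Y : FinCorr.{u}) : Type u where
  rel : Set (Y.carrier × X.carrier)

/-- The category `𝒞` of finite sets and correspondences. For `S ⊆ Y × X` and `R ⊆ Z × Y`, the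
composite `S ≫ R` (written `RS` in the usual order) is
`{(z, x) | ∃ y, (z, y) ∈ R ∧ (y, x) ∈ S}`. -/
instance : Category FinCorr.{u} where
  Hom X Y := Correspondence X Y
  id X := ⟨{p | p.1 = p.2}⟩
  comp {X Y Z} S R :=
    ⟨{p | ∃ y : Y.carrier, (p.1, y) ∈ R.rel ∧ (y, p.2) ∈ S.rel}⟩
  id_comp f := by
    apply Correspondence.ext
    ext ⟨a, b⟩
    simp
  comp_id f := by
    apply Correspondence.ext
    ext ⟨a, b⟩
    simp
  assoc f g h := by
    apply Correspondence.ext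
    ext ⟨a, b⟩
    constructor
    · rintro ⟨y, hy, z, hz, hx⟩
      exact ⟨z, ⟨y, hy, hz⟩, hx⟩
    · rintro ⟨z, ⟨y, hy, hz⟩, hx⟩
      exact ⟨y, hy, z, hz, hx⟩

end FinCorr

/-- A correspondence functor over `k`: a `k`-linear functor from the `k`-linearization `k𝒞` of the
category of finite sets and correspondences to the category of `k`-modules. -/
structure CorrFunctor (k : Type v) [CommRing k] where
  toFunctor : Free k FinCorr.{u} ⥤ ModuleCat.{w} k
  [additive : toFunctor.Additive]
  [linear : toFunctor.Linear k]

namespace CorrFunctor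

attribute [instance] CorrFunctor.additive CorrFunctor.linear

variable {k : Type v} [CommRing k]

/-- The evaluation `M(X)`. -/
abbrev eval (M : CorrFunctor.{u, v, w} k) (X : Free k FinCorr.{u}) : Type w :=
  M.toFunctor.obj X

/-- The action `m ↦ α · m` of a morphism `α` of `k𝒞` from `X` to `Y`. -/
abbrev act (M : CorrFunctor.{u, v, w} k) {X Y : Free k FinCorr.{u}} (α : X ⟶ Y) :
    M.eval X →ₗ[k] M.eval Y :=
  (M.toFunctor.map α).hom

theorem act_id (M : CorrFunctor.{u, v, w} k) (X : Free k FinCorr.{u}) :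
    M.act (𝟙 X) = LinearMap.id := by
  rw [act, M.toFunctor.map_id]; rfl

theorem act_comp (M : CorrFunctor.{u, v, w} k) {X Y Z : Free k FinCorr.{u}} (α : X ⟶ Y)
    (β : Y ⟶ Z) : M.act (α ≫ β) = M.act β ∘ₗ M.act α := by
  rw [act, M.toFunctor.map_comp]; rfl

theorem act_add (M : CorrFunctor.{u, v, w} k) {X Y : Free k FinCorr.{u}} (α β : X ⟶ Y) :
    M.act (α + β) = M.act α + M.act β := by
  rw [act, M.toFunctor.map_add]; rfl

theorem act_smul (M : CorrFunctor.{u, v, w} k) {X Y : Free k FinCorr.{u}} (r : k) (α : X ⟶ Y) :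
    M.act (r • α) = r • M.act α := by
  rw [act, M.toFunctor.map_smul]; rfl

/-- `M` is generated by the family of elements `m i ∈ M(E i)`. -/
def IsGeneratedBy (M : CorrFunctor.{u, v, w} k) {I : Type*} (E : I → Free k FinCorr.{u})
    (m : ∀ i, M.eval (E i)) : Prop :=
  ∀ (X : Free k FinCorr.{u}) (x : M.eval X),
    ∃ (J : Finset I) (α : ∀ j : I, E j ⟶ X), x = ∑ j ∈ J, M.act (α j) (m j)

/-- `M` is finitely generated: it is generated by a finite family of elements. -/
def IsFinitelyGenerated (M : CorrFunctor.{u, v, w} k) : Prop :=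
  ∃ (n : ℕ) (E : Fin n → Free k FinCorr.{u}) (m : ∀ i, M.eval (E i)), M.IsGeneratedBy E m

/-- A subfunctor of `M`: a submodule of each evaluation `M(X)`, stable under all morphisms. -/
@[ext]
structure Subfunctor (M : CorrFunctor.{u, v, w} k) where
  obj : ∀ X : Free k FinCorr.{u}, Submodule k (M.eval X)
  act_mem : ∀ {X Y : Free k FinCorr.{u}} (α : X ⟶ Y) {x : M.eval X},
    x ∈ obj X → M.act α x ∈ obj Y

namespace Subfunctor

variable {M : CorrFunctor.{u, v, w} k}

/-- Subfunctors are ordered by inclusion of all evaluations. -/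
instance : PartialOrder (Subfunctor M) :=
  PartialOrder.lift Subfunctor.obj fun _ _ h => Subfunctor.ext h

/-- The zero subfunctor and the whole functor. -/
instance : BoundedOrder (Subfunctor M) where
  top := ⟨fun _ => ⊤, fun _ _ _ => Submodule.mem_top⟩
  le_top _ := fun _ => le_top
  bot := ⟨fun _ => ⊥, fun α x hx => by
    rw [Submodule.mem_bot] at hx
    rw [hx, map_zero]
    exact Submodule.zero_mem _⟩
  bot_le _ := fun _ => bot_le

/-- The action of `α` on a subfunctor, by restriction. -/
def actOn (N : Subfunctor M) {X Y : Free k FinCorr.{u}} (α : X ⟶ Y) : N.obj X →ₗ[k] N.obj Y :=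
  (M.act α).restrict fun _ hx => N.act_mem α hx

theorem actOn_id (N : Subfunctor M) (X : Free k FinCorr.{u}) :
    N.actOn (𝟙 X) = LinearMap.id := by
  ext x
  exact LinearMap.congr_fun (M.act_id X) x.1

theorem actOn_comp (N : Subfunctor M) {X Y Z : Free k FinCorr.{u}} (α : X ⟶ Y) (β : Y ⟶ Z) :
    N.actOn (α ≫ β) = N.actOn β ∘ₗ N.actOn α := by
  ext x
  exact LinearMap.congr_fun (M.act_comp α β) x.1

theorem actOn_add (N : Subfunctor M) {X Y : Free k FinCorr.{u}} (α β : X ⟶ Y) :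
    N.actOn (α + β) = N.actOn α + N.actOn β := by
  ext x
  exact LinearMap.congr_fun (M.act_add α β) x.1

theorem actOn_smul (N : Subfunctor M) {X Y : Free k FinCorr.{u}} (r : k) (α : X ⟶ Y) :
    N.actOn (r • α) = r • N.actOn α := by
  ext x
  exact LinearMap.congr_fun (M.act_smul r α) x.1

/-- A subfunctor, regarded as a correspondence functor. -/
def toCorrFunctor (N : Subfunctor M) : CorrFunctor.{u, v, w} k where
  toFunctor :=
    { obj := fun X => ModuleCat.of k (N.obj X)
      map := fun α => ModuleCat.ofHom (N.actOn α)
      map_id := fun X => by rw [actOn_id]; rfl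
      map_comp := fun α β => by rw [actOn_comp]; rfl }
  additive := ⟨fun {X Y} {α β} => by
    change ModuleCat.ofHom (N.actOn (α + β)) = _
    rw [actOn_add]; rfl⟩
  linear := ⟨fun {X Y} α r => by
    change ModuleCat.ofHom (N.actOn (r • α)) = _
    rw [actOn_smul]; rfl⟩

/-- The kernel `A(X)` of `B(X) → (B / A)(X)`, as a submodule of `B(X)`, for `A ⊆ B`. -/
abbrev rel (A B : Subfunctor M) (X : Free k FinCorr.{u}) : Submodule k (B.obj X) :=
  (A.obj X).submoduleOf (B.obj X)

/-- The action of `α` on `B(X) / A(X)`, induced by that on `B(X)`. -/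
def actQuot (A B : Subfunctor M) {X Y : Free k FinCorr.{u}} (α : X ⟶ Y) :
    (B.obj X ⧸ rel A B X) →ₗ[k] (B.obj Y ⧸ rel A B Y) :=
  Submodule.mapQ (rel A B X) (rel A B Y) (B.actOn α) fun _ hx => A.act_mem α hx

/-- The subquotient `B / A` of `M`, for subfunctors `A ⊆ B`: its evaluation at `X` is
`B(X) / A(X)`, with the action induced by that of `M`. -/
def subquotient (A B : Subfunctor M) : CorrFunctor.{u, v, w} k where
  toFunctor :=
    { obj := fun X => ModuleCat.of k (B.obj X ⧸ rel A B X)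
      map := fun α => ModuleCat.ofHom (actQuot A B α)
      map_id := fun X => by
        have h : actQuot A B (𝟙 X) = LinearMap.id := by
          apply Submodule.linearMap_qext
          ext x
          exact congrArg Submodule.Quotient.mk (LinearMap.congr_fun (B.actOn_id X) x)
        rw [h]; rfl
      map_comp := fun {X Y Z} α β => by
        have h : actQuot A B (α ≫ β) = actQuot A B β ∘ₗ actQuot A B α := by
          apply Submodule.linearMap_qext
          ext x
          exact congrArg Submodule.Quotient.mk (LinearMap.congr_fun (B.actOn_comp α β) x)
        rw [h]; rfl }
  additive := ⟨fun {X Y} {α β} => by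
    have h : actQuot A B (α + β) = actQuot A B α + actQuot A B β := by
      apply Submodule.linearMap_qext
      ext x
      exact congrArg Submodule.Quotient.mk (LinearMap.congr_fun (B.actOn_add α β) x)
    change ModuleCat.ofHom (actQuot A B (α + β)) = _
    rw [h]; rfl⟩
  linear := ⟨fun {X Y} α r => by
    have h : actQuot A B (r • α) = r • actQuot A B α := by
      apply Submodule.linearMap_qext
      ext x
      exact congrArg Submodule.Quotient.mk (LinearMap.congr_fun (B.actOn_smul r α) x)
    change ModuleCat.ofHom (actQuot A B (r • α)) = _
    rw [h]; rfl⟩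

end Subfunctor

/-- `M` is nonzero: some evaluation of `M` is nonzero. -/
def IsNonzero (M : CorrFunctor.{u, v, w} k) : Prop :=
  ∃ X : Free k FinCorr.{u}, Nontrivial (M.eval X)

/-- `M` is simple: it is nonzero and has no proper nonzero subfunctor. -/
def IsSimple (M : CorrFunctor.{u, v, w} k) : Prop :=
  M.IsNonzero ∧ ∀ N : Subfunctor M, N = ⊥ ∨ N = ⊤

/-- `M` has finite length: it has a finite composition series
`M = F 0 ⊇ F 1 ⊇ ... ⊇ F n = 0` with every `F i / F (i + 1)` simple. -/
def HasFiniteLength (M : CorrFunctor.{u, v, w} k) : Prop :=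
  ∃ (n : ℕ) (F : Fin (n + 1) → Subfunctor M), F 0 = ⊤ ∧ F (Fin.last n) = ⊥ ∧
    ∀ i : Fin n, F i.succ ≤ F i.castSucc ∧
      (Subfunctor.subquotient (F i.succ) (F i.castSucc)).IsSimple

end CorrFunctor

/-! The proof compares growth rates. Counting correspondences bounds the dimension of `M(X)` by `c *
b ^ |X|` with `b = 2 ^ e`, and every subquotient `Q = B / A` inherits this bound. If `Q ≠ 0` and `E`
is a smallest set with `Q(E) ≠ 0`, then `dim Q(E ⊔ {1, …, m}) ≥ |E| ^ m` for all `m`, which forces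
`|E| ≤ b`. So a subquotient vanishing at one set `F` with `|F| = b` is zero: `N ↦ N(F)` is strictly
monotone into the subspaces of a finite-dimensional space. Both chain conditions, finite generation
and maximal subfunctors follow.

The lower bound comes from `exists_partialOrder_actRel_eq`: minimality of `E` yields an order on `E`
and a vector `v ∈ Q(E)` on which reflexive relations act as 1 or 0. Moving `v` along the `|E| ^ m`
retractions of `E ⊔ {1, …, m}` onto `E` gives vectors with a unitriangular pairing matrix. -/

/-- A family of vectors whose images under suitable linear maps form a unitriangular matrix with
respect to a partial order is linearly independent. -/
theorem linearIndependent_of_map_eq_ite {k V W ι : Type*} [DivisionRing k] [AddCommGroup V]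
    [Module k V] [AddCommGroup W] [Module k W] [PartialOrder ι] (w : ι → V) (f : ι → V →ₗ[k] W)
    {v : W} (hv : v ≠ 0) (h₁ : ∀ i, f i (w i) = v) (h₀ : ∀ i j, ¬ i ≤ j → f i (w j) = 0) :
    LinearIndependent k w := by
  classical
  rw [linearIndependent_iff']
  by_contra! h
  obtain ⟨s, g, hg, i, hi, hgi⟩ := h
  -- For `j` maximal in the support of a linear relation, `f j` kills every other term of it.
  obtain ⟨j, hj⟩ := (s.filter fun i => g i ≠ 0).exists_maximal ⟨i, by simp [hi, hgi]⟩
  have hjs := hj.prop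
  rw [Finset.mem_filter] at hjs
  have hs := congrArg (f j) hg
  rw [map_zero, map_sum, Finset.sum_eq_single j, map_smul, h₁] at hs
  · exact (smul_ne_zero hjs.2 hv) hs
  · intro l hl hlj
    rw [map_smul]
    by_cases hgl : g l = 0
    · rw [hgl, zero_smul]
    · rw [h₀ _ _ fun hjl => hlj (le_antisymm (hj.le_of_ge (by simp [hl, hgl]) hjl) hjl), smul_zero]
  · exact fun hj' => absurd hjs.1 hj'

/-! ### Action of correspondences and minimal sets -/

namespace CorrFunctor

section CommRing

variable {k : Type v} [CommRing k]

/-- The action of a single correspondence `S ⊆ Y × X`. -/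
noncomputable def actRel (M : CorrFunctor.{u, v, w} k) {X Y : FinCorr.{u}} (S : Set (Y.carrier × X.carrier)) :
    M.eval (Free.of k X) →ₗ[k] M.eval (Free.of k Y) :=
  M.act ((Free.embedding k FinCorr.{u}).map (⟨S⟩ : FinCorr.Correspondence X Y))

theorem actRel_diagonal (M : CorrFunctor.{u, v, w} k) {X : FinCorr.{u}}
    {S : Set (X.carrier × X.carrier)} (hS : ∀ a b, (a, b) ∈ S ↔ a = b)
    (x : M.eval (Free.of k X)) : M.actRel S x = x := by
  have h : (⟨S⟩ : FinCorr.Correspondence X X) = 𝟙 X := by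
    apply FinCorr.Correspondence.ext
    ext ⟨a, b⟩
    exact hS a b
  rw [actRel, h]
  exact (LinearMap.congr_fun (congrArg M.act ((Free.embedding k FinCorr.{u}).map_id X)) x).trans
    (LinearMap.congr_fun (M.act_id _) x)

theorem actRel_actRel (M : CorrFunctor.{u, v, w} k) {X Y Z : FinCorr.{u}}
    (R : Set (Z.carrier × Y.carrier)) (S : Set (Y.carrier × X.carrier))
    (x : M.eval (Free.of k X)) :
    M.actRel R (M.actRel S x) =
      M.actRel {p | ∃ y, (p.1, y) ∈ R ∧ (y, p.2) ∈ S} x := by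
  have h := (Free.embedding k FinCorr.{u}).map_comp (⟨S⟩ : FinCorr.Correspondence X Y)
    (⟨R⟩ : FinCorr.Correspondence Y Z)
  exact ((LinearMap.congr_fun (congrArg M.act h) x).trans
    (LinearMap.congr_fun (M.act_comp _ _) x)).symm

/-- The action of a morphism of `k𝒞` is a linear combination of actions of correspondences. -/
theorem act_mem_span_actRel (M : CorrFunctor.{u, v, w} k) {X Y : FinCorr.{u}}
    (α : Free.of k X ⟶ Free.of k Y) (x : M.eval (Free.of k X)) :
    M.act α x ∈ Submodule.span k
      (Set.range fun S : Set (Y.carrier × X.carrier) => M.actRel S x) := by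
  have key : ∀ α : (X ⟶ Y) →₀ k, M.act (X := Free.of k X) (Y := Free.of k Y) α x ∈
      Submodule.span k (Set.range fun S : Set (Y.carrier × X.carrier) => M.actRel S x) := by
    intro α
    induction α using Finsupp.induction_linear with
    | zero =>
      have h : M.act (0 : Free.of k X ⟶ Free.of k Y) = 0 := by
        rw [act, M.toFunctor.map_zero]; rfl
      exact (LinearMap.congr_fun h x).symm ▸ Submodule.zero_mem _
    | add f g hf hg =>
      exact (LinearMap.congr_fun (M.act_add (X := Free.of k X) (Y := Free.of k Y) f g) x).symm ▸
        Submodule.add_mem _ hf hg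
    | single S r =>
      have h : r • (Free.embedding k FinCorr.{u}).map S =
          (Finsupp.single S r : Free.of k X ⟶ Free.of k Y) := Finsupp.smul_single_one S r
      have h' : r • M.actRel (FinCorr.Correspondence.rel S) x =
          M.act (Finsupp.single S r : Free.of k X ⟶ Free.of k Y) x :=
        LinearMap.congr_fun ((M.act_smul r _).symm.trans (congrArg M.act h)) x
      exact h' ▸ Submodule.smul_mem _ _ (Submodule.subset_span ⟨_, rfl⟩)
  exact key α

/-- If `M(Y) = 0` for `|Y| < |E|` then every correspondence factoring through the complement of a
point of `E` acts as zero. -/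
theorem actRel_eq_zero_of_factor (M : CorrFunctor.{u, v, w} k) {E : FinCorr.{u}}
    (hM : ∀ Y : FinCorr.{u}, Nat.card Y.carrier < Nat.card E.carrier →
      Subsingleton (M.eval (Free.of k Y)))
    {R : Set (E.carrier × E.carrier)} (b : E.carrier)
    (hR : ∀ x z, (x, z) ∈ R ↔ ∃ y, y ≠ b ∧ (x, y) ∈ R ∧ (y, z) ∈ R)
    (x : M.eval (Free.of k E)) : M.actRel R x = 0 := by
  let Y : FinCorr.{u} := ⟨{y : E.carrier // y ≠ b}⟩
  have hY : Subsingleton (M.eval (Free.of k Y)) := by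
    refine hM Y ?_
    have := Fintype.ofFinite E.carrier
    classical
    simp only [Nat.card_eq_fintype_card]
    exact Fintype.card_subtype_lt (x := b) (by simp)
  -- The two restrictions of `R` compose to `R` by `hR`, and `M(Y) = 0` in between.
  let R₁ : Set (Y.carrier × E.carrier) := {p | (p.1.1, p.2) ∈ R}
  let R₂ : Set (E.carrier × Y.carrier) := {p | (p.1, p.2.1) ∈ R}
  have h := M.actRel_actRel R₂ R₁ x
  rw [Subsingleton.elim (M.actRel R₁ x) 0, map_zero] at h
  rw [h]
  congr
  ext ⟨a, c⟩
  rw [hR]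
  constructor
  · rintro ⟨y, hy, h₁, h₂⟩
    exact ⟨⟨y, hy⟩, h₁, h₂⟩
  · rintro ⟨y, h₁, h₂⟩
    exact ⟨y.1, y.2, h₁, h₂⟩

/-- If `E` is a set of minimal cardinality with `M(E) ≠ 0`, there is a partial order on `E` and a
nonzero element of `M(E)` that is fixed by the reflexive relations contained in the order and
killed by all other reflexive relations. -/
theorem exists_partialOrder_actRel_eq (M : CorrFunctor.{u, v, w} k) {E : FinCorr.{u}}
    (hM : ∀ Y : FinCorr.{u}, Nat.card Y.carrier < Nat.card E.carrier →
      Subsingleton (M.eval (Free.of k Y)))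
    (hE : Nontrivial (M.eval (Free.of k E))) :
    ∃ (_ : PartialOrder E.carrier) (v : M.eval (Free.of k E)), v ≠ 0 ∧
      ∀ T : Set (E.carrier × E.carrier), (∀ a, (a, a) ∈ T) →
        ((∀ a b, (a, b) ∈ T → a ≤ b) → M.actRel T v = v) ∧
        (¬ (∀ a b, (a, b) ∈ T → a ≤ b) → M.actRel T v = 0) := by
  let P : Set (Set (E.carrier × E.carrier)) :=
    {S | (∀ a, (a, a) ∈ S) ∧ ∃ x, M.actRel S x ≠ 0}
  have hne : P.Nonempty := by
    obtain ⟨x, hx⟩ := exists_ne (0 : M.eval (Free.of k E))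
    refine ⟨{p | p.1 = p.2}, fun _ => rfl, x, ?_⟩
    rwa [M.actRel_diagonal (fun _ _ => Iff.rfl)]
  obtain ⟨S, hS⟩ := P.toFinite.exists_maximal hne
  obtain ⟨hrefl, x, hx⟩ := hS.prop
  -- `R` is the largest relation with `RS ⊆ S`: it compares the rows of `S` by inclusion, hence is a
  -- preorder.
  let R : Set (E.carrier × E.carrier) := {p | ∀ c, (p.2, c) ∈ S → (p.1, c) ∈ S}
  have hRtrans : ∀ a b c, (a, b) ∈ R → (b, c) ∈ R → (a, c) ∈ R :=
    fun a b c h₁ h₂ d hd => h₁ d (h₂ d hd)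
  have hRrefl : ∀ a, (a, a) ∈ R := fun a c h => h
  have hfix : ∀ T : Set (E.carrier × E.carrier), (∀ a, (a, a) ∈ T) → T ⊆ R →
      M.actRel T (M.actRel S x) = M.actRel S x := by
    intro T hT hTR
    rw [actRel_actRel]
    congr
    ext ⟨a, c⟩
    constructor
    · rintro ⟨y, h₁, h₂⟩
      exact hTR h₁ c h₂
    · intro h
      exact ⟨a, hT a, h⟩
  have hkill : ∀ T : Set (E.carrier × E.carrier), (∀ a, (a, a) ∈ T) → ¬ T ⊆ R →
      M.actRel T (M.actRel S x) = 0 := by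
    intro T hT hTR
    by_contra h
    rw [actRel_actRel] at h
    apply hTR
    rintro ⟨a, b⟩ hab c hbc
    -- Since `T` is reflexive, `TS ⊇ S`; if `TS` acted nontrivially, maximality would give `TS = S`,
    -- so `T ⊆ R`.
    have hTS : {p : E.carrier × E.carrier | ∃ y, (p.1, y) ∈ T ∧ (y, p.2) ∈ S} ∈ P :=
      ⟨fun d => ⟨d, hT d, hrefl d⟩, x, h⟩
    exact hS.le_of_ge hTS (fun p hp => ⟨p.1, hT p.1, hp⟩) ⟨b, hab, hbc⟩
  have hanti : ∀ a b, (a, b) ∈ R → (b, a) ∈ R → a = b := by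
    intro a b hab hba
    by_contra hne
    apply hx
    rw [← hfix R hRrefl subset_rfl]
    -- If `a ≠ b` were equivalent under `R`, then `a` could replace `b` as an intermediate point, so
    -- `R` would factor through `E \ {b}` and act as zero, although it fixes `Sx ≠ 0`.
    refine M.actRel_eq_zero_of_factor hM b (fun y z => ⟨fun hyz => ?_, ?_⟩) _
    · by_cases hy : y = b
      · subst hy
        exact ⟨a, hne, hba, hRtrans _ _ _ hab hyz⟩
      · exact ⟨y, hy, hRrefl y, hyz⟩
    · rintro ⟨c, -, h₁, h₂⟩
      exact hRtrans _ _ _ h₁ h₂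
  refine ⟨{ le := fun a b => (a, b) ∈ R
            le_refl := hRrefl
            le_trans := hRtrans
            le_antisymm := hanti }, M.actRel S x, hx, fun T hT => ⟨fun h => ?_, fun h => ?_⟩⟩
  · exact hfix T hT fun p hp => h p.1 p.2 hp
  · exact hkill T hT fun h' => h fun a b hab => h' hab

end CommRing

/-! ### Exponential lower bound -/

section Field

variable {k : Type v} [Field k]

/-- If `E` is a set of minimal cardinality with `M(E) ≠ 0`, then `M(E ⊔ {1, …, m})` contains
`|E| ^ m` linearly independent elements. -/
theorem exists_linearIndependent (M : CorrFunctor.{u, v, w} k) {E : FinCorr.{u}}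
    (hM : ∀ Y : FinCorr.{u}, Nat.card Y.carrier < Nat.card E.carrier →
      Subsingleton (M.eval (Free.of k Y)))
    (hE : Nontrivial (M.eval (Free.of k E))) (m : ℕ) :
    ∃ w : (Fin m → E.carrier) →
        M.eval (Free.of k (⟨E.carrier ⊕ ULift.{u} (Fin m)⟩ : FinCorr.{u})),
      LinearIndependent k w := by
  obtain ⟨_, v, hv, h⟩ := M.exists_partialOrder_actRel_eq hM hE
  let X : FinCorr.{u} := ⟨E.carrier ⊕ ULift.{u} (Fin m)⟩
  -- `q φ` is the retraction of `X` onto `E` extending `φ`; `S φ` is its reversed graph and `S' ψ`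
  -- is the graph of `q ψ`. The composite of `S φ` with `S' ψ` is reflexive, and lies in the order
  -- exactly when `ψ ≤ φ`.
  let q (φ : Fin m → E.carrier) : X.carrier → E.carrier := Sum.elim id fun i => φ i.down
  let S (φ : Fin m → E.carrier) : Set (X.carrier × E.carrier) := {p | q φ p.1 = p.2}
  let S' (ψ : Fin m → E.carrier) : Set (E.carrier × X.carrier) := {p | q ψ p.2 = p.1}
  have hle : ∀ φ ψ, (∀ a b, (∃ y, q ψ y = a ∧ q φ y = b) → a ≤ b) ↔ ψ ≤ φ := by
    intro φ ψ
    constructor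
    · exact fun H i => H _ _ ⟨Sum.inr ⟨i⟩, rfl, rfl⟩
    · rintro H a b ⟨y | y, rfl, rfl⟩
      · exact le_rfl
      · exact H y.down
  have hrefl : ∀ φ ψ (a : E.carrier), ∃ y, q ψ y = a ∧ q φ y = a :=
    fun φ ψ a => ⟨Sum.inl a, rfl, rfl⟩
  refine ⟨fun φ => M.actRel (S φ) v, linearIndependent_of_map_eq_ite _
    (fun ψ => M.actRel (S' ψ)) hv (fun ψ => ?_) fun ψ φ hψφ => ?_⟩
  · rw [actRel_actRel]
    exact (h _ (hrefl ψ ψ)).1 ((hle ψ ψ).2 le_rfl)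
  · rw [actRel_actRel]
    exact (h _ (hrefl φ ψ)).2 fun H => hψφ ((hle φ ψ).1 H)

end Field

end CorrFunctor

/-- As `n / b > 1`, its powers eventually exceed the constant `c * b ^ d`. -/
theorem exists_mul_pow_add_lt_pow {b n : ℕ} (hb : 0 < b) (hbn : b < n) (c d : ℕ) :
    ∃ m, c * b ^ (d + m) < n ^ m := by
  have hb' : (0 : ℚ) < b := Nat.cast_pos.2 hb
  obtain ⟨m, hm⟩ := pow_unbounded_of_one_lt (c * b ^ d : ℚ)
    ((one_lt_div hb').2 (Nat.cast_lt.2 hbn) : (1 : ℚ) < n / b)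
  refine ⟨m, ?_⟩
  rw [div_pow, lt_div_iff₀ (pow_pos hb' m), mul_assoc, ← pow_add] at hm
  exact_mod_cast hm

namespace CorrFunctor

section CommRing

variable {k : Type v} [CommRing k]

/-- If `M(F) = 0` then `M(Y) = 0` for `|Y| ≤ |F|`. -/
theorem subsingleton_eval_of_card_le (M : CorrFunctor.{u, v, w} k) {Y F : FinCorr.{u}}
    (hYF : Nat.card Y.carrier ≤ Nat.card F.carrier) (hF : Subsingleton (M.eval (Free.of k F))) :
    Subsingleton (M.eval (Free.of k Y)) := by
  have := Fintype.ofFinite Y.carrier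
  have := Fintype.ofFinite F.carrier
  simp only [Nat.card_eq_fintype_card] at hYF
  obtain ⟨i⟩ := Function.Embedding.nonempty_of_card_le hYF
  refine subsingleton_of_forall_eq 0 fun x => ?_
  -- Injectivity of `i` makes its graph followed by the reversed graph the identity of `Y`, so the
  -- identity of `M(Y)` factors through `M(F) = 0`.
  let S : Set (F.carrier × Y.carrier) := {p | p.1 = i p.2}
  let S' : Set (Y.carrier × F.carrier) := {p | p.2 = i p.1}
  have h := M.actRel_actRel S' S x
  rw [Subsingleton.elim (M.actRel S x) 0, map_zero, actRel_diagonal] at h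
  · exact h.symm
  · intro a b
    constructor
    · rintro ⟨y, h₁, h₂⟩
      exact i.injective (h₁.symm.trans h₂)
    · rintro rfl
      exact ⟨i a, rfl, rfl⟩

/-! ### Subfunctors, subquotients and composition series -/

namespace Subfunctor

variable {M : CorrFunctor.{u, v, w} k}

/-- The subfunctor generated by a finite family of elements. -/
def closure (M : CorrFunctor.{u, v, w} k) {n : ℕ} {E : Fin n → Free k FinCorr.{u}}
    (m : ∀ i, M.eval (E i)) : Subfunctor M where
  obj X :=
    { carrier := {x | ∃ α : ∀ i, E i ⟶ X, x = ∑ i, M.act (α i) (m i)}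
      zero_mem' := ⟨fun _ => 0, by simp [act]⟩
      add_mem' := by
        rintro _ _ ⟨α, rfl⟩ ⟨β, rfl⟩
        exact ⟨fun i => α i + β i, by simp [act_add, Finset.sum_add_distrib]⟩
      smul_mem' := by
        rintro r _ ⟨α, rfl⟩
        exact ⟨fun i => r • α i, by simp [act_smul, Finset.smul_sum]⟩ }
  act_mem := by
    rintro X Y β _ ⟨α, rfl⟩
    exact ⟨fun i => α i ≫ β, by simp [act_comp]⟩

theorem mem_closure {n : ℕ} {E : Fin n → Free k FinCorr.{u}} {m : ∀ i, M.eval (E i)}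
    {X : Free k FinCorr.{u}} {x : M.eval X} :
    x ∈ (closure M m).obj X ↔ ∃ α : ∀ i, E i ⟶ X, x = ∑ i, M.act (α i) (m i) :=
  Iff.rfl

theorem self_mem_closure {n : ℕ} {E : Fin n → Free k FinCorr.{u}} (m : ∀ i, M.eval (E i))
    (i : Fin n) : m i ∈ (closure M m).obj (E i) := by
  classical
  refine mem_closure.2 ⟨fun j => if h : j = i then eqToHom (by rw [h]) else 0, ?_⟩
  rw [Finset.sum_eq_single i]
  · simp [act_id]
  · intro j _ hj
    simp [hj, act]
  · simp

/-- The preimage in `C` of a subfunctor of `C / A`. -/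
def comapSubquotient (A C : Subfunctor M) (N : Subfunctor (subquotient A C)) : Subfunctor M where
  obj X := ((N.obj X).comap (rel A C X).mkQ).map (C.obj X).subtype
  act_mem := by
    rintro X Y α _ ⟨x, hx, rfl⟩
    exact ⟨C.actOn α x, N.act_mem α hx, rfl⟩

theorem mem_comapSubquotient {A C : Subfunctor M} {N : Subfunctor (subquotient A C)}
    {X : Free k FinCorr.{u}} (x : C.obj X) :
    x.1 ∈ (comapSubquotient A C N).obj X ↔ (rel A C X).mkQ x ∈ N.obj X := by
  constructor
  · rintro ⟨y, hy, hyx⟩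
    rwa [← Subtype.ext hyx]
  · exact fun h => ⟨x, h, rfl⟩

theorem isNonzero_subquotient {A C : Subfunctor M} (h : A < C) : (subquotient A C).IsNonzero := by
  by_contra H
  apply h.not_ge
  intro X x hx
  by_contra hxA
  refine H ⟨X, ⟨(rel A C X).mkQ ⟨x, hx⟩, 0, fun h0 => hxA ?_⟩⟩
  exact (Submodule.Quotient.mk_eq_zero (rel A C X)).1 h0

/-- A subfunctor of `C / A` pulls back to one between `A` and `C`, hence to `A` or `C`. -/
theorem isSimple_subquotient {A C : Subfunctor M} (h : A ⋖ C) : (subquotient A C).IsSimple := by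
  refine ⟨isNonzero_subquotient h.lt, fun N => ?_⟩
  have hA : A ≤ comapSubquotient A C N := fun X x hx =>
    (mem_comapSubquotient (N := N) ⟨x, h.le X hx⟩).2 (by
      have h0 : (rel A C X).mkQ ⟨x, h.le X hx⟩ = 0 := (Submodule.Quotient.mk_eq_zero _).2 hx
      rw [h0]
      exact Submodule.zero_mem _)
  have hC : comapSubquotient A C N ≤ C := by
    rintro X _ ⟨x, -, rfl⟩
    exact x.2
  rcases h.eq_or_eq hA hC with h' | h'
  · left
    rw [eq_bot_iff]
    intro X y hy
    obtain ⟨x, rfl⟩ := (rel A C X).mkQ_surjective y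
    have hx := (mem_comapSubquotient (N := N) x).2 hy
    rw [h'] at hx
    exact (Submodule.Quotient.mk_eq_zero (rel A C X)).2 hx
  · right
    rw [eq_top_iff]
    intro X y _
    obtain ⟨x, rfl⟩ := (rel A C X).mkQ_surjective y
    refine (mem_comapSubquotient (N := N) x).1 ?_
    rw [h']
    exact x.2

end Subfunctor

/-- A correspondence functor whose lattice of subfunctors satisfies both chain conditions has
finite length. -/
theorem hasFiniteLength_of_wellFounded (M : CorrFunctor.{u, v, w} k)
    [WellFoundedLT (Subfunctor M)] [WellFoundedGT (Subfunctor M)] : M.HasFiniteLength := by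
  obtain ⟨a, h0, n, hn, h⟩ := exists_covBy_seq_of_wellFoundedLT_wellFoundedGT (Subfunctor M)
  -- The covering sequence `a` ascends from `⊥`; a composition series descends from `⊤`.
  refine ⟨n, fun i => a (n - i), ?_, ?_, fun i => ?_⟩
  · simpa using hn.eq_top
  · simpa using h0.eq_bot
  · have hi := h (n - (i + 1)) (by have := i.2; omega)
    rw [show n - (i.1 + 1) + 1 = n - i from by have := i.2; omega] at hi
    exact ⟨hi.le, Subfunctor.isSimple_subquotient hi⟩

end CommRing

/-! ### Exponential upper bound and detection at one finite set -/

section Field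

variable {k : Type v} [Field k]

/-- The evaluations of a finitely generated correspondence functor have finite dimension, bounded
by an exponential function of the cardinality. -/
theorem IsFinitelyGenerated.finrank_le {M : CorrFunctor.{u, v, w} k} (hM : M.IsFinitelyGenerated) :
    ∃ c e : ℕ, ∀ X : FinCorr.{u}, Module.Finite k (M.eval (Free.of k X)) ∧
      Module.finrank k (M.eval (Free.of k X)) ≤ c * (2 ^ e) ^ Nat.card X.carrier := by
  obtain ⟨n, E, m, hm⟩ := hM
  let E' (i : Fin n) : FinCorr.{u} := E i
  -- Each of the `n` generators contributes at most `2 ^ (|X| * |E i|)` spanning vectors; the sum of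
  -- the `|E i|` bounds every exponent uniformly.
  refine ⟨n, ∑ i, Nat.card (E' i).carrier, fun X => ?_⟩
  have (i : Fin n) := Fintype.ofFinite (E' i).carrier
  have := Fintype.ofFinite X.carrier
  classical
  let g : (Σ i, Set (X.carrier × (E' i).carrier)) → M.eval (Free.of k X) :=
    fun p => M.actRel (X := E' p.1) p.2 (m p.1)
  have hg : Submodule.span k (Set.range g) = ⊤ := by
    rw [eq_top_iff]
    rintro x -
    obtain ⟨J, α, rfl⟩ := hm (Free.of k X) x
    refine Submodule.sum_mem _ fun i _ => ?_
    refine Submodule.span_mono ?_ (M.act_mem_span_actRel (X := E' i) (α i) (m i))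
    rintro _ ⟨S, rfl⟩
    exact ⟨⟨i, S⟩, rfl⟩
  refine ⟨⟨⟨(Set.finite_range g).toFinset, by simpa using hg⟩⟩, ?_⟩
  have h := finrank_range_le_card (R := k) g
  rw [Set.finrank, hg, finrank_top, Fintype.card_sigma] at h
  refine h.trans ((Finset.sum_le_card_nsmul _ _ ((2 ^ ∑ i, Nat.card (E' i).carrier) ^
    Nat.card X.carrier) fun i _ => ?_).trans (by simp))
  rw [Fintype.card_set, Fintype.card_prod, ← pow_mul, mul_comm, Nat.card_eq_fintype_card]
  refine Nat.pow_le_pow_right two_pos (Nat.mul_le_mul_right _ ?_)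
  rw [← Nat.card_eq_fintype_card]
  exact Finset.single_le_sum (f := fun i => Nat.card (E' i).carrier) (fun _ _ => Nat.zero_le _)
    (Finset.mem_univ i)

/-- If the evaluations of `M` grow at most like `b ^ |X|`, then an inclusion of subfunctors of `M`
that is an equality at one set of cardinality at least `b` is an equality. -/
theorem Subfunctor.le_of_obj_le {M : CorrFunctor.{u, v, w} k} {b c : ℕ} (hb : 0 < b)
    (hM : ∀ X : FinCorr.{u}, Module.Finite k (M.eval (Free.of k X)) ∧
      Module.finrank k (M.eval (Free.of k X)) ≤ c * b ^ Nat.card X.carrier)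
    {F : FinCorr.{u}} (hF : b ≤ Nat.card F.carrier) {A B : Subfunctor M} (hAB : A ≤ B)
    (h : B.obj (Free.of k F) ≤ A.obj (Free.of k F)) : B ≤ A := by
  by_contra hBA
  let Q := subquotient A B
  have hQF : Subsingleton (Q.eval (Free.of k F)) :=
    Submodule.Quotient.subsingleton_iff.2 (Submodule.submoduleOf_eq_top.2 h)
  have hex : ∃ n, ∃ X : FinCorr.{u}, Nat.card X.carrier = n ∧
      Nontrivial (Q.eval (Free.of k X)) := by
    obtain ⟨X, hX⟩ := isNonzero_subquotient (lt_of_le_not_ge hAB hBA)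
    exact ⟨_, X, rfl, hX⟩
  classical
  obtain ⟨E, hEn, hE⟩ := Nat.find_spec hex
  have hmin : ∀ Y : FinCorr.{u}, Nat.card Y.carrier < Nat.card E.carrier →
      Subsingleton (Q.eval (Free.of k Y)) := fun Y hY =>
    not_nontrivial_iff_subsingleton.1 fun hY' => Nat.find_min hex (hEn ▸ hY) ⟨Y, rfl, hY'⟩
  have hbE : b < Nat.card E.carrier := by
    by_contra! hle
    have := Q.subsingleton_eval_of_card_le (hle.trans hF) hQF
    exact not_subsingleton _ this
  -- The shift is `|E|` because the upper bound is applied to `E ⊔ {1, …, m}`, which has `|E| + m`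
  -- elements.
  obtain ⟨m, hm⟩ := exists_mul_pow_add_lt_pow hb hbE c (Nat.card E.carrier)
  obtain ⟨w, hw⟩ := Q.exists_linearIndependent hmin hE m
  let X : FinCorr.{u} := ⟨E.carrier ⊕ ULift.{u} (Fin m)⟩
  obtain ⟨hfin, hle⟩ := hM X
  have := Fintype.ofFinite E.carrier
  have hX : Nat.card X.carrier = Nat.card E.carrier + m := by
    simp [X]
  have hfinQ : Module.Finite k (Q.eval (Free.of k X)) :=
    inferInstanceAs (Module.Finite k (B.obj (Free.of k X) ⧸ rel A B (Free.of k X)))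
  have hcard := hw.fintype_card_le_finrank
  have hQM : Module.finrank k (Q.eval (Free.of k X)) ≤ Module.finrank k (M.eval (Free.of k X)) :=
    (Submodule.finrank_quotient_le (rel A B (Free.of k X))).trans (Submodule.finrank_le _)
  rw [Fintype.card_fun, Fintype.card_fin, ← Nat.card_eq_fintype_card] at hcard
  rw [hX] at hle
  exact absurd (hcard.trans (hQM.trans hle)) (not_le.2 hm)

/-- For a finitely generated `M` there is a set `F` with `M(F)` of finite dimension such that
evaluation at `F` is injective on comparable subfunctors of `M`. -/
theorem IsFinitelyGenerated.exists_detecting {M : CorrFunctor.{u, v, w} k}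
    (hM : M.IsFinitelyGenerated) :
    ∃ F : Free k FinCorr.{u}, Module.Finite k (M.eval F) ∧
      ∀ A B : Subfunctor M, A ≤ B → B.obj F ≤ A.obj F → B ≤ A := by
  obtain ⟨c, e, h⟩ := hM.finrank_le
  let F : FinCorr.{u} := ⟨ULift.{u} (Fin (2 ^ e))⟩
  exact ⟨Free.of k F, (h F).1, fun A B hAB =>
    Subfunctor.le_of_obj_le (F := F) (Nat.two_pow_pos e) h (by simp [F]) hAB⟩

/-- A finite spanning family of `N(F)` generates a subfunctor of `N` that agrees with `N` at `F`,
hence everywhere. -/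
theorem Subfunctor.isFinitelyGenerated_of_detecting {M : CorrFunctor.{u, v, w} k}
    {F : Free k FinCorr.{u}} (hfin : Module.Finite k (M.eval F))
    (hF : ∀ A B : Subfunctor M, A ≤ B → B.obj F ≤ A.obj F → B ≤ A) (N : Subfunctor M) :
    N.toCorrFunctor.IsFinitelyGenerated := by
  obtain ⟨n, s, hs⟩ := Module.Finite.exists_fin (R := k) (M := N.obj F)
  let m (i : Fin n) : M.eval F := (s i).1
  have hle : closure M (E := fun _ => F) m ≤ N := by
    rintro X _ ⟨α, rfl⟩
    exact Submodule.sum_mem _ fun i _ => N.act_mem (α i) (s i).2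
  have hge : N.obj F ≤ (closure M (E := fun _ => F) m).obj F := by
    intro x hx
    have h : (⟨x, hx⟩ : N.obj F) ∈ Submodule.span k (Set.range s) := hs ▸ Submodule.mem_top
    have h' : Submodule.span k (Set.range s) ≤
        ((closure M (E := fun _ => F) m).obj F).submoduleOf (N.obj F) := by
      rw [Submodule.span_le]
      rintro _ ⟨i, rfl⟩
      exact self_mem_closure (E := fun _ => F) m i
    exact h' h
  refine ⟨n, fun _ => F, s, fun X x => ?_⟩
  obtain ⟨α, hα⟩ := hF _ _ hle hge X x.2
  refine ⟨Finset.univ, α, Subtype.ext ?_⟩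
  exact hα.trans (map_sum (N.obj X).subtype (fun i => N.actOn (α i) (s i)) Finset.univ).symm

end Field

end CorrFunctor

theorem mainTheorem2 {k : Type v} [Field k] (M : CorrFunctor.{u, v, w} k)
    (hM : M.IsFinitelyGenerated) :
    M.HasFiniteLength ∧
    (∀ N : CorrFunctor.Subfunctor M, N.toCorrFunctor.IsFinitelyGenerated) ∧
    (∀ N : CorrFunctor.Subfunctor M, N ≠ ⊥ → ∃ F : CorrFunctor.Subfunctor M, F ⋖ N) := by
  obtain ⟨F, hfin, hF⟩ := hM.exists_detecting
  -- Strict monotonicity pulls both chain conditions back from the subspaces of the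
  -- finite-dimensional `M(F)`.
  have hmono : StrictMono fun N : CorrFunctor.Subfunctor M => N.obj F := fun A B h =>
    lt_of_le_not_ge (h.le F) fun h' => h.not_ge (hF A B h.le h')
  have := hmono.wellFoundedLT
  have := hmono.wellFoundedGT
  refine ⟨M.hasFiniteLength_of_wellFounded, fun N => N.isFinitelyGenerated_of_detecting hfin hF,
    fun N hN => ?_⟩
  exact exists_covBy_of_wellFoundedGT fun h => hN h.eq_bot
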